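/- Let $G$ be a group, written multiplicatively with identity element $e$, that is torsion-free (no element other than $e$ has finite order) and hypercentral (every non-trivial factor group of $G$ has a non-trivial center). Let $R$ be a unital, not necessarily associative ring which is $G$-graded, i.e. there are additive subgroups $R_g$ of $R$ ($g\in G$) such that $R=\bigoplus_{g\in G}R_g$ and $R_gR_h\subseteq R_{gh}$ for all $g,h\in G$. Put $\operatorname{supp}(R)=\{g\in G : R_g\neq\{0\}\}$. Assume that $\operatorname{supp}(R)=G$ and that the grading is faithful: for all $g,h\in\operatorname{supp}(R)$ and all non-zero $r\in R_g$ we have $rR_h\neq\{0\}\neq R_hr$. Let $Z(R)$ be the center of $R$, i.e. the set of elements of $R$ that commute with every element of $R$ and associate with all pairs of elements of $R$ (in each of the three positions). Call a two-sided ideal $I$ of $R$ graded if $I=\bigoplus_{g\in G}(I\cap R_g)$, and call $R$ graded simple if its only graded two-sided ideals are $\{0\}$ and $R$. Then $R$ is simple (its only two-sided ideals are $\{0\}$ and $R$, and $R\neq\{0\}$) if and only if $R$ is graded simple and $Z(R)\subseteq R_e$. -/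

import Mathlib

/-- `G` is hypercentral: every non-trivial factor group of `G` has non-trivial center. -/
def IsHypercentral (G : Type*) [Group G] : Prop :=
  ∀ (N : Subgroup G) [N.Normal], Nontrivial (G ⧸ N) → Nontrivial (Subgroup.center (G ⧸ N))

/-- `G` is torsion-free: only the identity element has finite order. -/
def IsTorsionFreeGroup (G : Type*) [Group G] : Prop :=
  ∀ g : G, g ≠ 1 → ¬ IsOfFinOrder g

/-- The additive subgroups `A g` make the (not necessarily associative) unital ring `R` into a
`G`-graded ring: `R` is their internal direct sum and `A g * A h ⊆ A (g * h)`. -/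
structure IsGroupGrading {G R : Type*} [Group G] [DecidableEq G] [NonAssocRing R]
    (A : G → AddSubgroup R) : Prop where
  isInternal : DirectSum.IsInternal A
  mul_mem : ∀ {g h : G} {x y : R}, x ∈ A g → y ∈ A h → x * y ∈ A (g * h)

/-- The support of a graded ring: the degrees whose homogeneous component is non-zero. -/
def gradingSupport {G R : Type*} [NonAssocRing R] (A : G → AddSubgroup R) : Set G :=
  {g | A g ≠ ⊥}

/-- The grading is faithful: for degrees `g`, `h` in the support and `0 ≠ r ∈ A g`, neither
`r * A h` nor `A h * r` is zero. -/
def IsFaithfulGrading {G R : Type*} [NonAssocRing R] (A : G → AddSubgroup R) : Prop :=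
  ∀ g ∈ gradingSupport A, ∀ h ∈ gradingSupport A, ∀ r ∈ A g, r ≠ 0 →
    (∃ s ∈ A h, r * s ≠ 0) ∧ (∃ s ∈ A h, s * r ≠ 0)

/-- The two-sided ideal `I` is graded: `I` is the sum of the subgroups `I ∩ A g`.  (For a
grading `A` this sum is automatically direct.) -/
def IsGradedIdeal {G R : Type*} [NonAssocRing R] (A : G → AddSubgroup R)
    (I : TwoSidedIdeal R) : Prop :=
  AddSubgroup.ofClass I = ⨆ g, AddSubgroup.ofClass I ⊓ A g

/-- `R` is graded simple: its only graded two-sided ideals are `0` and `R`. -/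
def IsGradedSimple {G R : Type*} [NonAssocRing R] (A : G → AddSubgroup R) : Prop :=
  ∀ I : TwoSidedIdeal R, IsGradedIdeal A I → I = ⊥ ∨ I = ⊤

/-!
Coarsen the grading along `G → G ⧸ N`. If the coarsened grading is graded simple, take in an ideal
a non-zero element supported in a single coset of the preimage of `Z(G ⧸ N)`, with as few
`G ⧸ N`-components as possible: normalised to have a component `1`, it is central, so it lies in
`A 1` and generates `R`. Hence the coarsening along the preimage of `Z(G ⧸ N)` is graded simple too,
and by Zorn's lemma one climbs from `N = ⊥` to `N = ⊤`, where every ideal is graded.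

Conversely, faithfulness makes the support of a central element stable under conjugation by degrees
in the support of `R`. In a torsion-free hypercentral group, having finitely many conjugates forces
commuting, so the components of a central element are central. In a simple ring a non-zero central
homogeneous `c` of degree `g ≠ 1` makes `1 - c` invertible, with an inverse of infinite support.
-/

section Hypercentral

open scoped commutatorElement

variable {G : Type*} [Group G]

theorem IsHypercentral.lt_comap_center (hG : IsHypercentral G) (N : Subgroup G) [N.Normal]
    (hN : N ≠ ⊤) : N < (Subgroup.center (G ⧸ N)).comap (QuotientGroup.mk' N) := by
  have : Nontrivial (G ⧸ N) := by
    rwa [← not_subsingleton_iff_nontrivial, QuotientGroup.subsingleton_iff]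
  have : Nontrivial (Subgroup.center (G ⧸ N)) := hG N this
  obtain ⟨⟨z, hz⟩, hz1⟩ := exists_ne (1 : Subgroup.center (G ⧸ N))
  obtain ⟨g, rfl⟩ := QuotientGroup.mk'_surjective N z
  refine SetLike.lt_iff_le_and_exists.2 ⟨fun n hn => ?_, g, hz, fun hg => hz1 ?_⟩
  · rw [Subgroup.mem_comap, QuotientGroup.mk'_apply, (QuotientGroup.eq_one_iff n).2 hn]
    exact one_mem _
  · exact Subtype.ext ((QuotientGroup.eq_one_iff g).2 hg)

theorem IsHypercentral.induction (hG : IsHypercentral G) {motive : Subgroup G → Prop}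
    (bot : motive ⊥)
    (sSup : ∀ c : Set (Subgroup G), c.Nonempty → IsChain (· ≤ ·) c →
      (∀ N ∈ c, N.Normal ∧ motive N) → motive (sSup c))
    (comap_center : ∀ (N : Subgroup G) [N.Normal], motive N →
      motive ((Subgroup.center (G ⧸ N)).comap (QuotientGroup.mk' N))) : motive ⊤ := by
  obtain ⟨N, -, ⟨hN, hmotive⟩, hmax⟩ := zorn_le_nonempty₀ {N : Subgroup G | N.Normal ∧ motive N}
    (fun c hc hchain M hM => ⟨_,
      ⟨Subgroup.sSup_normal c fun N hN => (hc hN).1, sSup c ⟨M, hM⟩ hchain fun N hN => hc hN⟩,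
      fun _ => le_sSup⟩)
    ⊥ ⟨inferInstance, bot⟩
  by_cases hT : N = ⊤
  · exact hT ▸ hmotive
  · have hlt := hG.lt_comap_center N hT
    exact absurd (hmax ⟨inferInstance, comap_center N hmotive⟩ hlt.le) hlt.not_ge

theorem exists_pow_commute_of_finite_range_conj {g h : G}
    (hfin : (Set.range fun n : ℕ => h ^ n * g * (h ^ n)⁻¹).Finite) :
    ∃ n ≠ 0, Commute g (h ^ n) := by
  obtain ⟨i, j, hij, heq⟩ := hfin.exists_lt_map_eq_of_forall_mem Set.mem_range_self
  obtain ⟨k, rfl⟩ := Nat.exists_eq_add_of_lt hij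
  refine ⟨k + 1, k.succ_ne_zero, ?_⟩
  refine (eq_mul_inv_iff_mul_eq.1 ((MulAut.conj (h ^ i)).injective ?_ : g = _))
  rw [← MulAut.conj_apply (h ^ (k + 1)), ← MulAut.mul_apply, ← map_mul, ← pow_add]
  exact heq

theorem IsTorsionFreeGroup.commute_of_commute_pow (htf : IsTorsionFreeGroup G) {g h : G} {n : ℕ}
    (hn : n ≠ 0) (hpow : Commute g (h ^ n)) (hcomm : Commute ⁅g, h⁆ h) : Commute g h := by
  have hconj : SemiconjBy g (h ^ n) (⁅g, h⁆ ^ n * h ^ n) := by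
    have : SemiconjBy g h (⁅g, h⁆ * h) := by simp [SemiconjBy, commutatorElement_def]
    simpa only [hcomm.mul_pow] using this.pow_right n
  have hone : ⁅g, h⁆ ^ n = 1 := by
    have := hpow.eq.symm.trans hconj.eq
    rwa [mul_assoc, right_eq_mul] at this
  by_contra hne
  exact htf ⁅g, h⁆ (mt commutatorElement_eq_one_iff_commute.1 hne)
    (isOfFinOrder_iff_pow_eq_one.2 ⟨n, hn.pos, hone⟩)

/- A commutator `⁅g, h⁆ = g * (h * g * h⁻¹)⁻¹` with `h ∈ S` again has finitely many conjugates under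
`S`, and it lies one step lower than `g` in the central series. -/
theorem IsHypercentral.commute_of_finite_conj (hG : IsHypercentral G) (htf : IsTorsionFreeGroup G)
    {S : Submonoid G} {g h : G} (hfin : ((fun a => a * g * a⁻¹) '' S).Finite) (hh : h ∈ S) :
    Commute g h := by
  suffices ∀ g ∈ (⊤ : Subgroup G), ((fun a => a * g * a⁻¹) '' S).Finite → ∀ h ∈ S, Commute g h from
    this g (Subgroup.mem_top g) hfin h hh
  clear hfin hh g h
  refine hG.induction (motive := fun N => ∀ g ∈ N, ((fun a => a * g * a⁻¹) '' S).Finite →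
    ∀ h ∈ S, Commute g h) ?bot ?sSup ?comap_center
  case bot =>
    rintro g hg - h -
    rw [Subgroup.mem_bot.1 hg]
    exact Commute.one_left h
  case sSup =>
    intro c hne hchain ih g hg
    obtain ⟨N, hN, hgN⟩ := (Subgroup.mem_sSup_of_directedOn hne hchain.directedOn).1 hg
    exact (ih N hN).2 g hgN
  case comap_center =>
    intro N _ ih g hg hfin h hh
    have hmem : ⁅g, h⁆ ∈ N := by
      rw [← QuotientGroup.eq_one_iff]
      exact commutatorElement_eq_one_iff_commute.2 (Subgroup.mem_center_iff.1 hg h).symm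
    have hfin_comm : ((fun a => a * ⁅g, h⁆ * a⁻¹) '' S).Finite := by
      refine (hfin.image2 (fun x y => x * y⁻¹) hfin).subset ?_
      rintro _ ⟨a, ha, rfl⟩
      refine ⟨_, ⟨a, ha, rfl⟩, _, ⟨a * h, mul_mem ha hh, rfl⟩, ?_⟩
      simp only [commutatorElement_def]
      group
    obtain ⟨n, hn, hpow⟩ := exists_pow_commute_of_finite_range_conj
      (hfin.subset (Set.range_subset_iff.2 fun n => ⟨h ^ n, pow_mem hh n, rfl⟩))
    exact htf.commute_of_commute_pow hn hpow (ih _ hmem hfin_comm h hh)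

theorem isOfFinOrder_of_mapsTo_mul_left {M : Type*} [CancelMonoid M] {F : Set M} (hF : F.Finite)
    (hne : F.Nonempty) {g : M} (hg : Set.MapsTo (g * ·) F F) : IsOfFinOrder g := by
  obtain ⟨k, hk⟩ := hne
  have hpow (n : ℕ) : g ^ n * k ∈ F := by
    induction n with
    | zero => rwa [pow_zero, one_mul]
    | succ n ih => rw [pow_succ', mul_assoc]; exact hg ih
  by_contra h
  exact Set.infinite_of_injective_forall_mem
    ((mul_left_injective k).comp (injective_pow_iff_not_isOfFinOrder.2 h)) hpow hF

end Hypercentral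

section HomogeneousComponents

variable {ι M : Type*}

/-- The sum of the subgroups `A i` with `i ∈ T`, that is, the elements of a graded group that are
supported in `T`. -/
def homogeneousSpan [AddGroup M] (A : ι → AddSubgroup M) (T : Set ι) : AddSubgroup M :=
  ⨆ i ∈ T, A i

/-- The coarsening of a grading along a map `f` of index sets. -/
def coarsen {κ : Type*} [AddGroup M] (A : ι → AddSubgroup M) (f : ι → κ) (k : κ) : AddSubgroup M :=
  homogeneousSpan A (f ⁻¹' {k})

section AddGroup

variable [AddGroup M] {A : ι → AddSubgroup M}

theorem homogeneousSpan_mono {S T : Set ι} (h : S ⊆ T) :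
    homogeneousSpan A S ≤ homogeneousSpan A T :=
  biSup_mono h

theorem homogeneousSpan_singleton (i : ι) : homogeneousSpan A {i} = A i :=
  iSup_singleton

theorem homogeneousSpan_empty : homogeneousSpan A ∅ = ⊥ :=
  iSup_emptyset

theorem le_homogeneousSpan {T : Set ι} {i : ι} (hi : i ∈ T) : A i ≤ homogeneousSpan A T :=
  le_biSup A hi

theorem homogeneousSpan_le {T : Set ι} {B : AddSubgroup M} (h : ∀ i ∈ T, A i ≤ B) :
    homogeneousSpan A T ≤ B :=
  iSup₂_le h

theorem le_coarsen {κ : Type*} (f : ι → κ) (i : ι) : A i ≤ coarsen A f (f i) :=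
  le_homogeneousSpan (T := f ⁻¹' {f i}) rfl

theorem homogeneousSpan_coarsen {κ : Type*} (f : ι → κ) (T : Set κ) :
    homogeneousSpan (coarsen A f) T = homogeneousSpan A (f ⁻¹' T) := by
  refine le_antisymm (homogeneousSpan_le fun k hk => ?_) (homogeneousSpan_le fun i hi => ?_)
  · exact homogeneousSpan_mono (Set.preimage_mono (Set.singleton_subset_iff.2 hk))
  · exact (le_coarsen f i).trans (le_homogeneousSpan hi)

end AddGroup

variable [AddCommGroup M] [DecidableEq ι] {A : ι → AddSubgroup M} (hA : DirectSum.IsInternal A)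

/-- The projection of an internal direct sum onto its summand `A i`. -/
noncomputable def homogeneousComponent (i : ι) : M →+ M :=
  letI := hA.chooseDecomposition
  (A i).subtype.comp <| (DFinsupp.evalAddMonoidHom i).comp
    (DirectSum.decomposeAddEquiv A).toAddMonoidHom

/-- The set of degrees in which an element has a non-zero component. -/
def homogeneousSupport (x : M) : Set ι :=
  {i | homogeneousComponent hA i x ≠ 0}

theorem mem_homogeneousSupport {x : M} {i : ι} :
    i ∈ homogeneousSupport hA x ↔ homogeneousComponent hA i x ≠ 0 :=
  Iff.rfl

theorem homogeneousComponent_mem (i : ι) (x : M) : homogeneousComponent hA i x ∈ A i :=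
  SetLike.coe_mem _

theorem homogeneousComponent_of_mem {i j : ι} {x : M} (hx : x ∈ A j) :
    homogeneousComponent hA i x = if i = j then x else 0 := by
  let := hA.chooseDecomposition
  split_ifs with hij
  · subst hij
    exact DirectSum.decompose_of_mem_same A hx
  · exact DirectSum.decompose_of_mem_ne A hx (Ne.symm hij)

theorem mem_of_forall_homogeneousComponent_mem {B : AddSubgroup M} {x : M}
    (h : ∀ i ∈ homogeneousSupport hA x, homogeneousComponent hA i x ∈ B) : x ∈ B := by
  classical
  let := hA.chooseDecomposition
  rw [← DirectSum.sum_support_decompose A x]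
  refine sum_mem fun i hi => h i fun h0 => ?_
  exact DFinsupp.mem_support_iff.1 hi (Subtype.ext h0)

theorem finite_homogeneousSupport (x : M) : (homogeneousSupport hA x).Finite := by
  classical
  let := hA.chooseDecomposition
  refine (DFinsupp.support (DirectSum.decompose A x)).finite_toSet.subset fun i hi => ?_
  exact DFinsupp.mem_support_iff.2 fun h => hi (congrArg Subtype.val h)

include hA in
theorem homogeneous_induction [Nonempty ι] {motive : M → Prop}
    (mem : ∀ i, ∀ x ∈ A i, motive x)
    (add : ∀ x y, motive x → motive y → motive (x + y)) (x : M) : motive x := by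
  let := hA.chooseDecomposition
  exact DirectSum.Decomposition.inductionOn A (mem (Classical.arbitrary ι) 0 (zero_mem _))
    (fun m => mem _ _ m.2) add x

theorem mem_homogeneousSpan_iff {T : Set ι} {x : M} :
    x ∈ homogeneousSpan A T ↔ homogeneousSupport hA x ⊆ T := by
  refine ⟨fun hx i hi => ?_, fun hx => mem_of_forall_homogeneousComponent_mem hA fun i hi =>
    le_homogeneousSpan (hx hi) (homogeneousComponent_mem hA i x)⟩
  by_contra hiT
  have hle : homogeneousSpan A T ≤ (homogeneousComponent hA i).ker :=
    homogeneousSpan_le fun j hj y hy => by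
      rw [AddMonoidHom.mem_ker, homogeneousComponent_of_mem hA hy,
        if_neg (ne_of_mem_of_not_mem hj hiT).symm]
  exact hi (hle hx)

theorem mem_iff_homogeneousSupport_subset {i : ι} {x : M} :
    x ∈ A i ↔ homogeneousSupport hA x ⊆ {i} := by
  rw [← mem_homogeneousSpan_iff, homogeneousSpan_singleton]

theorem homogeneousSupport_nonempty {x : M} (hx : x ≠ 0) :
    (homogeneousSupport hA x).Nonempty := by
  rwa [Set.nonempty_iff_ne_empty, Ne, ← Set.subset_empty_iff, ← mem_homogeneousSpan_iff,
    homogeneousSpan_empty, AddSubgroup.mem_bot]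

include hA in
theorem disjoint_homogeneousSpan {S T : Set ι} (h : Disjoint S T) :
    Disjoint (homogeneousSpan A S) (homogeneousSpan A T) := by
  refine AddSubgroup.disjoint_def.2 fun {x} hS hT => ?_
  by_contra hx
  obtain ⟨i, hi⟩ := homogeneousSupport_nonempty hA hx
  exact Set.disjoint_left.1 h ((mem_homogeneousSpan_iff hA).1 hS hi)
    ((mem_homogeneousSpan_iff hA).1 hT hi)

include hA in
theorem isInternal_coarsen {κ : Type*} [DecidableEq κ] (f : ι → κ) :
    DirectSum.IsInternal (coarsen A f) := by
  constructor
  · refine iSupIndep.dfinsuppSumAddHom_injective fun k => ?_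
    change Disjoint _ (homogeneousSpan (coarsen A f) {j | j ≠ k})
    rw [homogeneousSpan_coarsen]
    exact disjoint_homogeneousSpan hA (Disjoint.preimage f (by simp))
  · refine AddMonoidHom.range_eq_top.1 (eq_top_iff.2 fun x _ => ?_)
    refine mem_of_forall_homogeneousComponent_mem hA fun i _ => ?_
    have hi : homogeneousComponent hA i x ∈ coarsen A f (f i) :=
      le_coarsen f i (homogeneousComponent_mem hA i x)
    exact ⟨_, DirectSum.coeAddMonoidHom_of (coarsen A f) (f i) ⟨_, hi⟩⟩

end HomogeneousComponents

open scoped Pointwise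

theorem mem_center_of_homogeneous {ι R : Type*} [NonAssocRing R] [DecidableEq ι] [Nonempty ι]
    {A : ι → AddSubgroup R} (hA : DirectSum.IsInternal A) {z : R}
    (comm : ∀ g, ∀ r ∈ A g, z * r = r * z)
    (left_assoc : ∀ g h, ∀ r ∈ A g, ∀ s ∈ A h, z * (r * s) = z * r * s)
    (right_assoc : ∀ g h, ∀ r ∈ A g, ∀ s ∈ A h, r * s * z = r * (s * z)) : z ∈ Set.center R := by
  refine ⟨fun r => ?_, fun r s => ?_, fun r s => ?_⟩
  · rw [commute_iff_eq]
    induction r using homogeneous_induction hA with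
    | mem g r hr => exact comm g r hr
    | add a b ha hb => rw [mul_add, add_mul, ha, hb]
  · induction r using homogeneous_induction hA with
    | mem g r hr =>
      induction s using homogeneous_induction hA with
      | mem h s hs => exact left_assoc g h r hr s hs
      | add a b ha hb => simp only [mul_add, ha, hb]
    | add a b ha hb => simp only [mul_add, add_mul, ha, hb]
  · induction r using homogeneous_induction hA with
    | mem g r hr =>
      induction s using homogeneous_induction hA with
      | mem h s hs => exact right_assoc g h r hr s hs
      | add a b ha hb => simp only [mul_add, add_mul, ha, hb]
    | add a b ha hb => simp only [add_mul, ha, hb]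

namespace IsGroupGrading

variable {G R : Type*} [Group G] [DecidableEq G] [NonAssocRing R] {A : G → AddSubgroup R}
  (hA : IsGroupGrading A)

include hA

theorem mul_mem_homogeneousSpan {S T : Set G} {x y : R} (hx : x ∈ homogeneousSpan A S)
    (hy : y ∈ homogeneousSpan A T) : x * y ∈ homogeneousSpan A (S * T) := by
  suffices homogeneousSpan A S ≤ (homogeneousSpan A (S * T)).comap (AddMonoidHom.mulRight y) from
    this hx
  refine homogeneousSpan_le fun g hg r hr => ?_
  suffices homogeneousSpan A T ≤ (homogeneousSpan A (S * T)).comap (AddMonoidHom.mulLeft r) from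
    this hy
  exact homogeneousSpan_le fun h hh s hs =>
    le_homogeneousSpan (Set.mul_mem_mul hg hh) (hA.mul_mem hr hs)

protected theorem coarsen {Q : Type*} [Group Q] [DecidableEq Q] (f : G →* Q) :
    IsGroupGrading (coarsen A f) where
  isInternal := isInternal_coarsen hA.isInternal f
  mul_mem {p q} _ _ hx hy := by
    refine homogeneousSpan_mono ?_ (hA.mul_mem_homogeneousSpan hx hy)
    rw [← Set.singleton_mul_singleton]
    exact Set.preimage_mul_preimage_subset f

theorem homogeneousComponent_mul_right {k : G} {t : R} (ht : t ∈ A k) (g : G) (x : R) :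
    homogeneousComponent hA.isInternal g (x * t) =
      homogeneousComponent hA.isInternal (g * k⁻¹) x * t := by
  induction x using homogeneous_induction hA.isInternal with
  | mem h x hx =>
    rw [homogeneousComponent_of_mem _ (hA.mul_mem hx ht), homogeneousComponent_of_mem _ hx,
      ite_mul, zero_mul]
    simp only [mul_inv_eq_iff_eq_mul]
  | add x y hx hy => simp only [add_mul, map_add, hx, hy]

theorem homogeneousComponent_mul_left {k : G} {t : R} (ht : t ∈ A k) (g : G) (x : R) :
    homogeneousComponent hA.isInternal g (t * x) =
      t * homogeneousComponent hA.isInternal (k⁻¹ * g) x := by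
  induction x using homogeneous_induction hA.isInternal with
  | mem h x hx =>
    rw [homogeneousComponent_of_mem _ (hA.mul_mem ht hx), homogeneousComponent_of_mem _ hx,
      mul_ite, mul_zero]
    simp only [inv_mul_eq_iff_eq_mul]
  | add x y hx hy => simp only [mul_add, map_add, hx, hy]

theorem one_mem : (1 : R) ∈ A 1 := by
  have mul_component_one (x : R) : x * homogeneousComponent hA.isInternal 1 1 = x := by
    induction x using homogeneous_induction hA.isInternal with
    | mem h x hx =>
      have := hA.homogeneousComponent_mul_left hx h 1
      rw [mul_one, inv_mul_cancel, homogeneousComponent_of_mem _ hx, if_pos rfl] at this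
      exact this.symm
    | add x y hx hy => rw [add_mul, hx, hy]
  rw [← mul_component_one 1, one_mul]
  exact homogeneousComponent_mem hA.isInternal 1 1

theorem homogeneousComponent_one (g : G) :
    homogeneousComponent hA.isInternal g (1 : R) = if g = 1 then 1 else 0 :=
  homogeneousComponent_of_mem _ hA.one_mem

end IsGroupGrading

section GradedSimple

variable {G R : Type*} [NonAssocRing R]

theorem IsGradedSimple.of_forall_eq_top {A : G → AddSubgroup R}
    (h : ∀ (I : TwoSidedIdeal R) (g : G), ∀ x ∈ I, x ∈ A g → x ≠ 0 → I = ⊤) :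
    IsGradedSimple A := by
  refine fun I hI => or_iff_not_imp_right.2 fun hne => le_bot_iff.1 fun x hx => ?_
  have hbot : ⨆ g, AddSubgroup.ofClass I ⊓ A g ≤ ⊥ := iSup_le fun g y hy => by
    by_contra hy0
    exact hne (h I g y hy.1 hy.2 hy0)
  exact (TwoSidedIdeal.mem_bot R).2 (hbot (hI.le hx))

variable [Group G] [DecidableEq G] {A : G → AddSubgroup R} (hA : IsGroupGrading A)

/-- The graded ideal with homogeneous components `K g ⊓ A g`, for a family `K` of additive subgroups
that is stable under multiplication by homogeneous elements. The `K g` need not lie in `A g`. -/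
def gradedIdeal (K : G → AddSubgroup R)
    (mul_left : ∀ {g h : G} {t r : R}, t ∈ A g → r ∈ K h → t * r ∈ K (g * h))
    (mul_right : ∀ {g h : G} {t r : R}, t ∈ A g → r ∈ K h → r * t ∈ K (h * g)) : TwoSidedIdeal R :=
  .mk' {x | ∀ g, homogeneousComponent hA.isInternal g x ∈ K g}
    (fun g => by rw [map_zero]; exact zero_mem _)
    (fun hx hy g => by rw [map_add]; exact add_mem (hx g) (hy g))
    (fun hx g => by rw [map_neg]; exact neg_mem (hx g))
    (fun {t r} hr => by
      induction t using homogeneous_induction hA.isInternal with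
      | mem k t ht =>
        intro g
        rw [hA.homogeneousComponent_mul_left ht]
        simpa only [mul_inv_cancel_left] using mul_left ht (hr (k⁻¹ * g))
      | add t s ht hs =>
        intro g
        rw [add_mul, map_add]
        exact add_mem (ht g) (hs g))
    (fun {r t} hr => by
      induction t using homogeneous_induction hA.isInternal with
      | mem k t ht =>
        intro g
        rw [hA.homogeneousComponent_mul_right ht]
        simpa only [inv_mul_cancel_right] using mul_right ht (hr (g * k⁻¹))
      | add t s ht hs =>
        intro g
        rw [mul_add, map_add]
        exact add_mem (ht g) (hs g))

section

variable {K : G → AddSubgroup R}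
  {mul_left : ∀ {g h : G} {t r : R}, t ∈ A g → r ∈ K h → t * r ∈ K (g * h)}
  {mul_right : ∀ {g h : G} {t r : R}, t ∈ A g → r ∈ K h → r * t ∈ K (h * g)}

theorem mem_gradedIdeal {x : R} : x ∈ gradedIdeal hA K mul_left mul_right ↔
    ∀ g, homogeneousComponent hA.isInternal g x ∈ K g := by
  rw [gradedIdeal, TwoSidedIdeal.mem_mk', Set.mem_ofPred_eq]

theorem mem_gradedIdeal_of_mem {g : G} {x : R} (hx : x ∈ A g) (hxK : x ∈ K g) :
    x ∈ gradedIdeal hA K mul_left mul_right := by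
  refine (mem_gradedIdeal hA).2 fun h => ?_
  rw [homogeneousComponent_of_mem _ hx]
  split_ifs with hgh
  · exact hgh ▸ hxK
  · exact zero_mem _

theorem isGradedIdeal_gradedIdeal : IsGradedIdeal A (gradedIdeal hA K mul_left mul_right) := by
  refine le_antisymm (fun x hx => ?_) (iSup_le fun g => inf_le_left)
  refine mem_of_forall_homogeneousComponent_mem hA.isInternal fun g _ => ?_
  have hg := homogeneousComponent_mem hA.isInternal g x
  exact AddSubgroup.mem_iSup_of_mem g
    ⟨mem_gradedIdeal_of_mem hA hg ((mem_gradedIdeal hA).1 hx g), hg⟩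

end

include hA

theorem IsGradedSimple.one_mem_of_mul_mem (hs : IsGradedSimple A) {K : G → AddSubgroup R}
    (mul_left : ∀ {g h : G} {t r : R}, t ∈ A g → r ∈ K h → t * r ∈ K (g * h))
    (mul_right : ∀ {g h : G} {t r : R}, t ∈ A g → r ∈ K h → r * t ∈ K (h * g))
    {g : G} {x : R} (hx : x ∈ A g) (hx0 : x ≠ 0) (hxK : x ∈ K g) : 1 ∈ K 1 := by
  have hmem : x ∈ gradedIdeal hA K mul_left mul_right := mem_gradedIdeal_of_mem hA hx hxK
  rcases hs _ (isGradedIdeal_gradedIdeal hA) with h | h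
  · exact absurd ((TwoSidedIdeal.mem_bot R).1 (h ▸ hmem)) hx0
  · have := (mem_gradedIdeal hA).1 ((TwoSidedIdeal.one_mem_iff _).2 h) 1
    rwa [hA.homogeneousComponent_one, if_pos rfl] at this

theorem IsGradedSimple.eq_top_of_mem (hs : IsGradedSimple A) {I : TwoSidedIdeal R} {g : G} {x : R}
    (hxI : x ∈ I) (hx : x ∈ A g) (hx0 : x ≠ 0) : I = ⊤ :=
  (TwoSidedIdeal.one_mem_iff I).1 <|
    hs.one_mem_of_mul_mem hA (K := fun _ => AddSubgroup.ofClass I)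
      (fun _ hr => I.mul_mem_left _ _ hr) (fun _ hr => I.mul_mem_right _ _ hr) hx hx0 hxI

end GradedSimple

namespace IsGroupGrading

variable {G R : Type*} [Group G] [DecidableEq G] [NonAssocRing R] {A : G → AddSubgroup R}
  (hA : IsGroupGrading A)

section CentralCosets

variable {S : Set G}

include hA

theorem mul_mem_homogeneousSpan_smul_left {k q : G} {t x : R} (ht : t ∈ A k)
    (hx : x ∈ homogeneousSpan A (q • S)) : t * x ∈ homogeneousSpan A ((k * q) • S) := by
  rw [← homogeneousSpan_singleton (A := A) k] at ht
  simpa only [← smul_eq_mul, Set.singleton_smul, smul_assoc] using hA.mul_mem_homogeneousSpan ht hx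

theorem mul_mem_homogeneousSpan_smul_right (hS : S ⊆ Subgroup.center G) {k q : G} {t x : R}
    (ht : t ∈ A k) (hx : x ∈ homogeneousSpan A (q • S)) :
    x * t ∈ homogeneousSpan A ((q * k) • S) := by
  rw [← homogeneousSpan_singleton (A := A) k] at ht
  refine homogeneousSpan_mono ?_ (hA.mul_mem_homogeneousSpan hx ht)
  rintro _ ⟨_, ⟨s, hs, rfl⟩, _, rfl, rfl⟩
  refine ⟨s, hs, ?_⟩
  simp only [smul_eq_mul, mul_assoc, Subgroup.mem_center_iff.1 (hS hs)]

theorem mem_center_of_eq_zero_of_homogeneousComponent_eq_zero (hS : S ⊆ Subgroup.center G)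
    {I : TwoSidedIdeal R}
    (hI : ∀ q : G, ∀ z ∈ I, z ∈ homogeneousSpan A (q • S) →
      homogeneousComponent hA.isInternal q z = 0 → z = 0)
    {y : R} (hyI : y ∈ I) (hyS : y ∈ homogeneousSpan A S)
    (hy1 : homogeneousComponent hA.isInternal 1 y = 1) : y ∈ Set.center R := by
  have hleft {k : G} {t : R} (ht : t ∈ A k) : t * y ∈ homogeneousSpan A (k • S) := by
    rw [← one_smul G S] at hyS
    simpa only [mul_one] using hA.mul_mem_homogeneousSpan_smul_left ht hyS
  have hright {k : G} {t : R} (ht : t ∈ A k) : y * t ∈ homogeneousSpan A (k • S) := by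
    rw [← one_smul G S] at hyS
    simpa only [one_mul] using hA.mul_mem_homogeneousSpan_smul_right hS ht hyS
  refine mem_center_of_homogeneous hA.isInternal (fun g r hr => ?comm)
    (fun g h r hr s hs => ?left_assoc) (fun g h r hr s hs => ?right_assoc) <;> rw [← sub_eq_zero]
  case comm =>
    refine hI g _ (I.sub_mem (I.mul_mem_right _ _ hyI) (I.mul_mem_left _ _ hyI))
      (sub_mem (hright hr) (hleft hr)) ?_
    simp only [map_sub, hA.homogeneousComponent_mul_right hr, hA.homogeneousComponent_mul_left hr,
      mul_inv_cancel, inv_mul_cancel, hy1, one_mul, mul_one, sub_self]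
  case left_assoc =>
    refine hI (g * h) _ (I.sub_mem (I.mul_mem_right _ _ hyI)
        (I.mul_mem_right _ _ (I.mul_mem_right _ _ hyI)))
      (sub_mem (hright (hA.mul_mem hr hs))
        (hA.mul_mem_homogeneousSpan_smul_right hS hs (hright hr))) ?_
    simp only [map_sub, hA.homogeneousComponent_mul_right (hA.mul_mem hr hs),
      hA.homogeneousComponent_mul_right hs, hA.homogeneousComponent_mul_right hr,
      mul_inv_cancel_right, mul_inv_cancel, hy1, one_mul, sub_self]
  case right_assoc =>
    refine hI (g * h) _ (I.sub_mem (I.mul_mem_left _ _ hyI)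
        (I.mul_mem_left _ _ (I.mul_mem_left _ _ hyI)))
      (sub_mem (hleft (hA.mul_mem hr hs))
        (hA.mul_mem_homogeneousSpan_smul_left hr (hleft hs))) ?_
    simp only [map_sub, hA.homogeneousComponent_mul_left (hA.mul_mem hr hs),
      hA.homogeneousComponent_mul_left hr, hA.homogeneousComponent_mul_left hs,
      inv_mul_cancel_left, inv_mul_cancel, hy1, mul_one, sub_self]

theorem exists_minimal_support_in_coset {I : TwoSidedIdeal R} {H : Subgroup G} {g : G} {x : R}
    (hxI : x ∈ I) (hx0 : x ≠ 0) (hx : x ∈ homogeneousSpan A (g • (H : Set G))) :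
    ∃ S ⊆ (H : Set G),
      (∃ (g₀ : G) (y : R), y ∈ I ∧ y ∈ homogeneousSpan A (g₀ • S) ∧
        homogeneousComponent hA.isInternal g₀ y ≠ 0) ∧
      ∀ q : G, ∀ z ∈ I, z ∈ homogeneousSpan A (q • S) →
        homogeneousComponent hA.isInternal q z = 0 → z = 0 := by
  obtain ⟨y, ⟨hyI, hy0, g, hy⟩, hmin⟩ := exists_minimalFor_of_wellFoundedLT
    (fun y => y ∈ I ∧ y ≠ 0 ∧ ∃ g : G, y ∈ homogeneousSpan A (g • (H : Set G)))
    (fun y => (homogeneousSupport hA.isInternal y).ncard) ⟨x, hxI, hx0, g, hx⟩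
  obtain ⟨g₀, hg₀⟩ := homogeneousSupport_nonempty hA.isInternal hy0
  obtain ⟨S, hyS⟩ : ∃ S : Set G, g₀ • S = homogeneousSupport hA.isInternal y :=
    ⟨_, smul_inv_smul g₀ _⟩
  have one_mem : 1 ∈ S := by
    rwa [← hyS, Set.mem_smul_set_iff_inv_smul_mem, smul_eq_mul, inv_mul_cancel] at hg₀
  have subset : S ⊆ H := by
    have hcoset {s : G} (hs : s ∈ S) : g⁻¹ * (g₀ * s) ∈ H :=
      Set.mem_smul_set_iff_inv_smul_mem.1 <|
        (mem_homogeneousSpan_iff hA.isInternal).1 hy (hyS ▸ Set.smul_mem_smul_set hs)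
    intro s hs
    have := H.mul_mem (H.inv_mem (hcoset one_mem)) (hcoset hs)
    rwa [show (g⁻¹ * (g₀ * 1))⁻¹ * (g⁻¹ * (g₀ * s)) = s by group] at this
  refine ⟨S, subset, ⟨g₀, y, hyI, (mem_homogeneousSpan_iff hA.isInternal).2 hyS.ge, hg₀⟩,
    fun q z hzI hz hzq => ?_⟩
  by_contra hz0
  have hss : homogeneousSupport hA.isInternal z ⊂ q • S :=
    ⟨(mem_homogeneousSpan_iff hA.isInternal).1 hz, fun h =>
      h (by simpa using Set.smul_mem_smul_set (a := q) one_mem : q ∈ q • S) hzq⟩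
  have hfin : S.Finite := by
    rw [← Set.finite_smul_set (a := g₀), hyS]
    exact finite_homogeneousSupport hA.isInternal y
  have hlt := Set.ncard_lt_ncard hss hfin.smul_set
  rw [Set.ncard_smul_set, ← Set.ncard_smul_set g₀ S, hyS] at hlt
  exact hlt.not_ge
    (hmin ⟨hzI, hz0, q, homogeneousSpan_mono (Set.smul_set_mono subset) hz⟩ hlt.le)

/- A non-zero element of `I` of minimal support within a coset of the center can be replaced, by
graded simplicity, by one with component `1` in degree `1`; its commutators and associators with
homogeneous elements then have smaller support. -/
theorem exists_mem_center_of_mem_homogeneousSpan (hs : IsGradedSimple A) {I : TwoSidedIdeal R}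
    {g : G} {x : R} (hxI : x ∈ I) (hx0 : x ≠ 0)
    (hx : x ∈ homogeneousSpan A (g • (Subgroup.center G : Set G))) :
    ∃ y ∈ I, y ≠ 0 ∧ y ∈ Set.center R := by
  obtain ⟨S, hS, ⟨g₀, z, hzI, hzS, hz0⟩, hI⟩ := hA.exists_minimal_support_in_coset hxI hx0 hx
  let K (q : G) : AddSubgroup R := (AddSubgroup.ofClass I ⊓ homogeneousSpan A (q • S)).map
    (homogeneousComponent hA.isInternal q)
  obtain ⟨y, ⟨hyI, hyS⟩, hy1⟩ : 1 ∈ K 1 := by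
    refine hs.one_mem_of_mul_mem hA (K := K) ?_ ?_ (homogeneousComponent_mem hA.isInternal g₀ z) hz0
      ⟨z, ⟨hzI, hzS⟩, rfl⟩
    · rintro k q t _ ht ⟨r, ⟨hrI, hrS⟩, rfl⟩
      refine ⟨t * r, ⟨I.mul_mem_left _ _ hrI, hA.mul_mem_homogeneousSpan_smul_left ht hrS⟩, ?_⟩
      rw [hA.homogeneousComponent_mul_left ht, inv_mul_cancel_left]
    · rintro k q t _ ht ⟨r, ⟨hrI, hrS⟩, rfl⟩
      refine ⟨r * t, ⟨I.mul_mem_right _ _ hrI, hA.mul_mem_homogeneousSpan_smul_right hS ht hrS⟩, ?_⟩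
      rw [hA.homogeneousComponent_mul_right ht, mul_inv_cancel_right]
  rw [one_smul] at hyS
  refine ⟨y, hyI, ?_,
    hA.mem_center_of_eq_zero_of_homogeneousComponent_eq_zero hS hI hyI hyS hy1⟩
  rintro rfl
  rw [map_zero] at hy1
  exact hx0 (by rw [← mul_one x, ← hy1, mul_zero])

end CentralCosets

end IsGroupGrading

section Coarsening

variable {G R : Type*} [Group G] [NonAssocRing R] {A : G → AddSubgroup R}

theorem coarsen_mk {N : Subgroup G} (g : G) :
    coarsen A (QuotientGroup.mk : G → G ⧸ N) g = homogeneousSpan A (g • (N : Set G)) := by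
  refine congrArg (homogeneousSpan A) (Set.ext fun h => ?_)
  rw [Set.mem_smul_set_iff_inv_smul_mem, Set.mem_preimage, Set.mem_singleton_iff, eq_comm,
    QuotientGroup.eq, smul_eq_mul, SetLike.mem_coe]

namespace IsGradedSimple

theorem of_forall_coset_eq_top {N : Subgroup G}
    (h : ∀ (I : TwoSidedIdeal R) (g : G), ∀ x ∈ I, x ∈ homogeneousSpan A (g • (N : Set G)) →
      x ≠ 0 → I = ⊤) :
    IsGradedSimple (coarsen A (QuotientGroup.mk : G → G ⧸ N)) :=
  of_forall_eq_top fun I q x hxI hx hx0 => by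
    obtain ⟨g, rfl⟩ := QuotientGroup.mk_surjective q
    exact h I g x hxI (coarsen_mk (A := A) g ▸ hx) hx0

variable [DecidableEq G] (hA : IsGroupGrading A)

include hA

theorem coset_eq_top {N : Subgroup G} [N.Normal]
    (hs : IsGradedSimple (coarsen A (QuotientGroup.mk : G → G ⧸ N))) {I : TwoSidedIdeal R} {g : G}
    {x : R} (hxI : x ∈ I) (hx : x ∈ homogeneousSpan A (g • (N : Set G))) (hx0 : x ≠ 0) : I = ⊤ := by
  classical
  exact hs.eq_top_of_mem (hA.coarsen (QuotientGroup.mk' N)) hxI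
    ((coarsen_mk (A := A) (N := N) g).ge hx) hx0

theorem coarsen_bot (hs : IsGradedSimple A) :
    IsGradedSimple (coarsen A (QuotientGroup.mk : G → G ⧸ (⊥ : Subgroup G))) := by
  refine of_forall_coset_eq_top fun I g x hxI hx hx0 => hs.eq_top_of_mem hA (g := g) hxI ?_ hx0
  rwa [Subgroup.coe_bot, Set.smul_set_singleton, smul_eq_mul, mul_one,
    homogeneousSpan_singleton] at hx

theorem coarsen_sSup {c : Set (Subgroup G)} (hne : c.Nonempty) (hchain : IsChain (· ≤ ·) c)
    (h : ∀ N ∈ c, N.Normal ∧ IsGradedSimple (coarsen A (QuotientGroup.mk : G → G ⧸ N))) :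
    IsGradedSimple (coarsen A (QuotientGroup.mk : G → G ⧸ sSup c)) := by
  refine of_forall_coset_eq_top fun I g x hxI hx hx0 => ?_
  have hcover : ((finite_homogeneousSupport hA.isInternal x).toFinset : Set G) ⊆
      ⋃ N ∈ c, g • (N : Set G) := by
    intro k hk
    rw [Set.Finite.coe_toFinset] at hk
    obtain ⟨m, hm, rfl⟩ := (mem_homogeneousSpan_iff hA.isInternal).1 hx hk
    obtain ⟨N, hN, hmN⟩ := (Subgroup.mem_sSup_of_directedOn hne hchain.directedOn).1 hm
    exact Set.mem_iUnion₂.2 ⟨N, hN, Set.smul_mem_smul_set hmN⟩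
  obtain ⟨N, hNc, hN⟩ := DirectedOn.exists_mem_subset_of_finset_subset_biUnion hne
    (hchain.directedOn.mono' fun M _ N _ hMN => Set.smul_set_mono hMN) hcover
  obtain ⟨_, hs⟩ := h N hNc
  refine hs.coset_eq_top hA (g := g) hxI ?_ hx0
  rwa [mem_homogeneousSpan_iff hA.isInternal, ← Set.Finite.coe_toFinset
    (finite_homogeneousSupport hA.isInternal x)]

theorem coarsen_comap_center (hc : Set.center R ⊆ (A 1 : Set R)) (hs : IsGradedSimple A)
    {N : Subgroup G} [N.Normal]
    (hN : IsGradedSimple (coarsen A (QuotientGroup.mk : G → G ⧸ N))) :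
    IsGradedSimple (coarsen A (QuotientGroup.mk :
      G → G ⧸ (Subgroup.center (G ⧸ N)).comap (QuotientGroup.mk' N))) := by
  classical
  refine of_forall_coset_eq_top fun I g x hxI hx hx0 => ?_
  have hx' : x ∈ homogeneousSpan (coarsen A (QuotientGroup.mk' N))
      ((g : G ⧸ N) • (Subgroup.center (G ⧸ N) : Set (G ⧸ N))) := by
    rw [homogeneousSpan_coarsen]
    refine homogeneousSpan_mono ?_ hx
    rintro _ ⟨m, hm, rfl⟩
    exact ⟨(m : G ⧸ N), hm, rfl⟩
  obtain ⟨y, hyI, hy0, hy⟩ :=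
    (hA.coarsen (QuotientGroup.mk' N)).exists_mem_center_of_mem_homogeneousSpan hN hxI hx0 hx'
  exact hs.eq_top_of_mem hA hyI (hc hy) hy0

theorem isSimpleRing [Nontrivial R] (hG : IsHypercentral G) (hs : IsGradedSimple A)
    (hc : Set.center R ⊆ (A 1 : Set R)) : IsSimpleRing R := by
  have htop : IsGradedSimple (coarsen A (QuotientGroup.mk : G → G ⧸ (⊤ : Subgroup G))) :=
    hG.induction
      (motive := fun N => IsGradedSimple (coarsen A (QuotientGroup.mk : G → G ⧸ N)))
      (hs.coarsen_bot hA) (fun _ => coarsen_sSup hA)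
      (fun _ _ => coarsen_comap_center hA hc hs)
  refine ⟨⟨fun I => or_iff_not_imp_right.2 fun hI => le_bot_iff.1 fun x hxI => ?_⟩⟩
  refine (TwoSidedIdeal.mem_bot R).2 (by_contra fun hx0 => hI ?_)
  refine htop.coset_eq_top hA (g := 1) hxI ?_ hx0
  rw [mem_homogeneousSpan_iff hA.isInternal, Subgroup.coe_top, Set.smul_set_univ]
  exact Set.subset_univ _

end IsGradedSimple

end Coarsening

section SimpleRing

variable {R : Type*} [NonAssocRing R] [IsSimpleRing R] {z : R}

theorem exists_mul_eq_one_of_mem_center (hz : z ∈ Set.center R) (hz0 : z ≠ 0) :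
    ∃ w, z * w = 1 := by
  let J : TwoSidedIdeal R := TwoSidedIdeal.mk' (Set.range (z * ·))
    ⟨0, mul_zero z⟩
    (by rintro _ _ ⟨a, rfl⟩ ⟨b, rfl⟩; exact ⟨a + b, mul_add z a b⟩)
    (by rintro _ ⟨a, rfl⟩; exact ⟨-a, mul_neg z a⟩)
    (by
      rintro r _ ⟨a, rfl⟩
      exact ⟨r * a, by simp only [(hz.comm _).eq, hz.right_assoc]⟩)
    (by rintro _ r ⟨a, rfl⟩; exact ⟨a * r, hz.left_assoc a r⟩)
  have hJ (r : R) : r ∈ J ↔ r ∈ Set.range (z * ·) := TwoSidedIdeal.mem_mk' _ _ _ _ _ _ r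
  rcases eq_bot_or_eq_top J with h | h
  · exact absurd ((TwoSidedIdeal.mem_bot R).1 (h ▸ (hJ z).2 ⟨1, mul_one z⟩)) hz0
  · exact (hJ 1).1 ((TwoSidedIdeal.one_mem_iff J).2 h)

theorem mul_ne_zero_of_mem_center (hz : z ∈ Set.center R) (hz0 : z ≠ 0) {u : R} (hu : u ≠ 0) :
    z * u ≠ 0 := by
  obtain ⟨w, hw⟩ := exists_mul_eq_one_of_mem_center hz hz0
  intro h
  refine hu ?_
  calc u = w * (z * u) := by rw [← hz.mid_assoc, ← (hz.comm w).eq, hw, one_mul]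
    _ = 0 := by rw [h, mul_zero]

end SimpleRing

theorem mem_gradingSupport_iff {G R : Type*} [NonAssocRing R] {A : G → AddSubgroup R} {g : G} :
    g ∈ gradingSupport A ↔ ∃ r ∈ A g, r ≠ 0 :=
  AddSubgroup.ne_bot_iff_exists_ne_zero.trans (by simp)

namespace IsGroupGrading

variable {G R : Type*} [Group G] [DecidableEq G] [NonAssocRing R] {A : G → AddSubgroup R}
  (hA : IsGroupGrading A)

/-- The support of a faithful grading of a non-trivial ring, as a submonoid of the group. -/
def supportSubmonoid [Nontrivial R] (hfaithful : IsFaithfulGrading A) : Submonoid G where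
  carrier := gradingSupport A
  one_mem' := mem_gradingSupport_iff.2 ⟨1, hA.one_mem, one_ne_zero⟩
  mul_mem' {g h} hg hh := by
    obtain ⟨r, hr, hr0⟩ := mem_gradingSupport_iff.1 hg
    obtain ⟨s, hs, hrs⟩ := (hfaithful g hg h hh r hr hr0).1
    exact mem_gradingSupport_iff.2 ⟨r * s, hA.mul_mem hr hs, hrs⟩

theorem conj_mem_homogeneousSupport_of_mem_center (hfaithful : IsFaithfulGrading A) {z : R}
    (hz : z ∈ Set.center R) {a g : G} (ha : a ∈ gradingSupport A)
    (hg : g ∈ homogeneousSupport hA.isInternal z) :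
    a * g * a⁻¹ ∈ homogeneousSupport hA.isInternal z := by
  have hg_mem := homogeneousComponent_mem hA.isInternal g z
  obtain ⟨s, hs, hne⟩ :=
    (hfaithful g (mem_gradingSupport_iff.2 ⟨_, hg_mem, hg⟩) a ha _ hg_mem hg).2
  have hcomp : s * homogeneousComponent hA.isInternal g z =
      homogeneousComponent hA.isInternal (a * g * a⁻¹) z * s := by
    rw [← hA.homogeneousComponent_mul_right hs, (hz.comm s).eq,
      hA.homogeneousComponent_mul_left hs, inv_mul_cancel_left]
  intro h
  rw [hcomp, h, zero_mul] at hne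
  exact hne rfl

theorem homogeneousComponent_mem_center {z : R} (hz : z ∈ Set.center R) {g : G}
    (hg : ∀ h ∈ gradingSupport A, Commute g h) :
    homogeneousComponent hA.isInternal g z ∈ Set.center R := by
  refine mem_center_of_homogeneous hA.isInternal (fun h r hr => ?comm)
    (fun h k r hr s hs => ?left_assoc) (fun h k r hr s hs => ?right_assoc)
  case comm =>
    obtain rfl | hr0 := eq_or_ne r 0
    · rw [mul_zero, zero_mul]
    have hgh := hg h (mem_gradingSupport_iff.2 ⟨r, hr, hr0⟩)
    have := congrArg (homogeneousComponent hA.isInternal (g * h)) (hz.comm r).eq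
    rwa [hA.homogeneousComponent_mul_right hr, hA.homogeneousComponent_mul_left hr,
      mul_inv_cancel_right, hgh.eq, inv_mul_cancel_left] at this
  case left_assoc =>
    have := congrArg (homogeneousComponent hA.isInternal (g * (h * k))) (hz.left_assoc r s)
    rwa [hA.homogeneousComponent_mul_right (hA.mul_mem hr hs), hA.homogeneousComponent_mul_right hs,
      hA.homogeneousComponent_mul_right hr, mul_inv_cancel_right, ← mul_assoc g,
      mul_inv_cancel_right, mul_inv_cancel_right] at this
  case right_assoc =>
    have := congrArg (homogeneousComponent hA.isInternal (h * k * g)) (hz.right_assoc r s)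
    rwa [hA.homogeneousComponent_mul_left (hA.mul_mem hr hs), hA.homogeneousComponent_mul_left hr,
      hA.homogeneousComponent_mul_left hs, inv_mul_cancel_left, mul_assoc h, inv_mul_cancel_left,
      inv_mul_cancel_left] at this

include hA

/- For `g ≠ 1` the inverse `y` of `1 - c` satisfies `y_k = c * y_{g⁻¹ * k}` for `k ≠ 1`, so its
finite support is stable under multiplication by `g` or by `g⁻¹`. -/
theorem isOfFinOrder_of_mem_center [IsSimpleRing R] {c : R} {g : G} (hc : c ∈ Set.center R)
    (hcg : c ∈ A g) (hc0 : c ≠ 0) : IsOfFinOrder g := by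
  obtain rfl | hg1 := eq_or_ne g 1
  · exact IsOfFinOrder.one
  have hsub0 : 1 - c ≠ 0 := fun h => one_ne_zero (α := R) <| by
    have := congrArg (homogeneousComponent hA.isInternal 1) h
    rwa [map_sub, map_zero, hA.homogeneousComponent_one, if_pos rfl,
      homogeneousComponent_of_mem _ hcg, if_neg hg1.symm, sub_zero] at this
  obtain ⟨y, hy⟩ := exists_mul_eq_one_of_mem_center
    (sub_eq_add_neg (1 : R) c ▸ Set.add_mem_center Set.one_mem_center (Set.neg_mem_center hc)) hsub0
  have hrec {k : G} (hk : k ≠ 1) : homogeneousComponent hA.isInternal k y =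
      c * homogeneousComponent hA.isInternal (g⁻¹ * k) y := by
    rw [← sub_eq_zero, ← hA.homogeneousComponent_mul_left hcg, ← map_sub, ← one_sub_mul, hy,
      hA.homogeneousComponent_one, if_neg hk]
  have hfin := finite_homogeneousSupport hA.isInternal y
  have hne := homogeneousSupport_nonempty hA.isInternal (x := y) <| by
    rintro rfl
    exact zero_ne_one ((mul_zero _).symm.trans hy)
  by_cases hy1 : 1 ∈ homogeneousSupport hA.isInternal y
  · refine isOfFinOrder_of_mapsTo_mul_left hfin hne fun k hk => ?_
    obtain h1 | h1 := eq_or_ne (g * k) 1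
    · exact h1.symm.subst hy1
    · rw [mem_homogeneousSupport, hrec h1, inv_mul_cancel_left]
      exact mul_ne_zero_of_mem_center hc hc0 hk
  · refine isOfFinOrder_inv_iff.1 (isOfFinOrder_of_mapsTo_mul_left hfin hne fun k hk h0 => ?_)
    rw [mem_homogeneousSupport, hrec (ne_of_mem_of_not_mem hk hy1), h0, mul_zero] at hk
    exact hk rfl

theorem center_subset_of_isSimpleRing [IsSimpleRing R] (hfaithful : IsFaithfulGrading A)
    (htf : IsTorsionFreeGroup G) (hG : IsHypercentral G) : Set.center R ⊆ (A 1 : Set R) := by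
  refine fun z hz => (mem_iff_homogeneousSupport_subset hA.isInternal).2 fun g hg => ?_
  have hconj : ((fun a => a * g * a⁻¹) '' gradingSupport A).Finite :=
    (finite_homogeneousSupport hA.isInternal z).subset <| Set.image_subset_iff.2 fun a ha =>
      hA.conj_mem_homogeneousSupport_of_mem_center hfaithful hz ha hg
  have hcentral : homogeneousComponent hA.isInternal g z ∈ Set.center R :=
    hA.homogeneousComponent_mem_center hz fun h hh =>
      hG.commute_of_finite_conj htf (S := hA.supportSubmonoid hfaithful) hconj hh
  by_contra hg1
  exact htf g hg1 (hA.isOfFinOrder_of_mem_center hcentral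
    (homogeneousComponent_mem hA.isInternal g z) hg)

end IsGroupGrading

theorem mainTheorem2_general {G R : Type*} [Group G] [DecidableEq G] [NonAssocRing R]
    [Nontrivial R] (A : G → AddSubgroup R) (hA : IsGroupGrading A)
    (hfaithful : IsFaithfulGrading A) (htf : IsTorsionFreeGroup G) (hhyp : IsHypercentral G) :
    IsSimpleRing R ↔ IsGradedSimple A ∧ Set.center R ⊆ (A 1 : Set R) :=
  ⟨fun _ => ⟨fun I _ => eq_bot_or_eq_top I,
      hA.center_subset_of_isSimpleRing hfaithful htf hhyp⟩,
    fun ⟨hs, hc⟩ => hs.isSimpleRing hA hhyp hc⟩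

theorem mainTheorem2 {G R : Type*} [Group G] [DecidableEq G] [NonAssocRing R]
    (A : G → AddSubgroup R) (hA : IsGroupGrading A)
    (hfaithful : IsFaithfulGrading A) (hsupp : gradingSupport A = Set.univ)
    (htf : IsTorsionFreeGroup G) (hhyp : IsHypercentral G) :
    IsSimpleRing R ↔ IsGradedSimple A ∧ Set.center R ⊆ (A 1 : Set R) := by
  obtain ⟨a, -, ha⟩ := mem_gradingSupport_iff.1 (hsupp.ge (Set.mem_univ (1 : G)))
  have : Nontrivial R := ⟨a, 0, ha⟩
  exact mainTheorem2_general A hA hfaithful htf hhyp
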